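/- A nonempty set $D\subseteq\{0,1\}^n$ is a binary orthogonal array with $n$ columns of strength $t$ if, for every choice of at most $t$ columns, each binary tuple occurs the same number of times among the rows of $D$ restricted to these columns (for $t\le n$ it suffices to consider exactly $t$ columns). Let $$F_D(x)=\sum_{i\le x}\frac{|\{(u,v)\in D^2 : d_H(u,v)=i\}|}{|D|^2},\qquad B_n(x)=\sum_{0\le i\le x}\binom{n}{i}2^{-n}\qquad(x\in\mathbb R)$$ be the cumulative distribution function of the Hamming distance $d_H$ between two elements of $D$ chosen uniformly and independently, and that of the symmetric binomial law. Let $n\to\infty$, let $k=k(n)$ be integers with $k\sim\theta n$, where $0<\theta<1$ is a real constant, and let $x=\frac n2+O(\sqrt n)$. Then any binary orthogonal array $D$ with $n$ columns, of strength at least $2k+1$, satisfies $$|F_D(x)-B_n(x)|=O\Big(\frac1{\sqrt n}\Big).$$ Precisely: for all $\theta\in(0,1)$ and $A\in\mathbb R$ there is a constant $C$ such that, for every sequence of integers $k(n)\ge 0$ with $k(n)\sim\theta n$ and for all sufficiently large $n$, the inequality $|F_D(x)-B_n(x)|\le C/\sqrt n$ holds for every real $x$ with $|x-\frac n2|\le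 A\sqrt n$ and every binary orthogonal array $D$ with $n$ columns, of strength at least $2k(n)+1$. -/

import Mathlib

open Filter Asymptotics

/-- `D`, seen as an array whose rows are its elements, is a binary orthogonal array of strength `t`
with `n` columns: in every choice of at most `t` columns, each tuple of symbols occurs as a
subrow the same number of times. For `t ≤ n` this is the same as asking it for choices of exactly
`t` columns; for `t > n` it is not vacuous, but says the same as `t = n`. -/
def IsBinaryOrthogonalArray {n : ℕ} (t : ℕ) (D : Finset (Fin n → ZMod 2)) : Prop :=
  ∀ S : Finset (Fin n), S.card ≤ t →
    ∃ N : ℕ, ∀ p : S → ZMod 2, (D.filter (fun r => ∀ i : S, r i = p i)).card = N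

/-- The frequency `f_i`: the proportion of pairs in `D × D` at Hamming distance `i`. -/
noncomputable def distFrequency {n : ℕ} (D : Finset (Fin n → ZMod 2)) (i : ℕ) : ℝ :=
  (((D ×ˢ D).filter (fun r => hammingDist r.1 r.2 = i)).card : ℝ) / (D.card : ℝ) ^ 2

/-- The cumulative distribution function `F_D` of the Hamming distance between two elements of `D`
chosen uniformly and independently. -/
noncomputable def distCDF {n : ℕ} (D : Finset (Fin n → ZMod 2)) (x : ℝ) : ℝ :=
  ∑ i ∈ (Finset.range (n + 1)).filter (fun i : ℕ => (i : ℝ) ≤ x), distFrequency D i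

/-- The cumulative distribution function `B_n` of the symmetric binomial law on `{0, …, n}`. -/
noncomputable def binomialCDF (n : ℕ) (x : ℝ) : ℝ :=
  ∑ i ∈ (Finset.range (n + 1)).filter (fun i : ℕ => (i : ℝ) ≤ x), (n.choose i : ℝ) / 2 ^ n

/-! The distance distribution of an array of strength `t` shares the moments of degree at most `t`
with the binomial law. Under `i ↦ arccos (1 - 2i/n)` these become cosine moments, by Chebyshev
polynomials. A nonnegative Jackson kernel of degree `2M - 2 ≤ t`, with `M` of order `n`, therefore
has the same integral against both laws.

Since neighbouring angles are at least of order `1/M` apart, a kernel peaked at one angle carries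
the bound `O(1/√n)` on binomial weights over to the frequencies of `D`. Summing kernels over the
nodes left of a threshold gives a smoothed step function, again with equal integrals; its error
decays quadratically in the distance `|i - m|` from the threshold index, hence is summable, and
meets only weights `O(1/√n)`. This is `abs_sum_sub_sum_le`. -/

/-! ### Binomial weights are at most `1/√n`. -/

theorem centralBinom_sq_mul_le (m : ℕ) : m.centralBinom ^ 2 * (2 * m + 1) ≤ 16 ^ m := by
  induction m with
  | zero => simp
  | succ m ih =>
    have h := Nat.succ_mul_centralBinom_succ m
    have h2 : (m + 1) ^ 2 * ((m + 1).centralBinom ^ 2 * (2 * (m + 1) + 1))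
        = 4 * (2 * m + 1) * (2 * m + 3) * (m.centralBinom ^ 2 * (2 * m + 1)) := by
      calc _ = ((m + 1) * (m + 1).centralBinom) ^ 2 * (2 * (m + 1) + 1) := by ring
        _ = _ := by rw [h]; ring
    refine Nat.le_of_mul_le_mul_left (c := (m + 1) ^ 2) ?_ (by positivity)
    rw [h2]
    calc _ ≤ 4 * (2 * m + 1) * (2 * m + 3) * 16 ^ m := by gcongr
      _ ≤ 16 * (m + 1) ^ 2 * 16 ^ m := Nat.mul_le_mul_right _ (by nlinarith)
      _ = _ := by ring

theorem choose_sq_mul_le (n i : ℕ) : n.choose i ^ 2 * n ≤ 4 ^ n := by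
  obtain ⟨m, rfl | rfl⟩ := n.even_or_odd'
  · calc _ ≤ m.centralBinom ^ 2 * (2 * m + 1) := by
          gcongr
          · exact Nat.choose_le_centralBinom i m
          · omega
      _ ≤ 16 ^ m := centralBinom_sq_mul_le m
      _ = _ := by rw [pow_mul]; norm_num
  -- The two equal middle entries of row `2m + 1` add up to the central entry of the next row.
  · have h1 : 2 * (2 * m + 1).choose i ≤ (m + 1).centralBinom := by
      have h := Nat.choose_le_middle i (2 * m + 1)
      rw [show (2 * m + 1) / 2 = m by omega] at h
      have h' : (m + 1).centralBinom = 2 * (2 * m + 1).choose m := by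
        rw [Nat.centralBinom_eq_two_mul_choose, show 2 * (m + 1) = (2 * m + 1) + 1 by ring,
          Nat.choose_succ_succ, ← Nat.choose_symm_half m]
        ring
      omega
    have h2 : 4 * ((2 * m + 1).choose i ^ 2 * (2 * m + 1)) ≤ 4 * 4 ^ (2 * m + 1) :=
      calc _ = (2 * (2 * m + 1).choose i) ^ 2 * (2 * m + 1) := by ring
        _ ≤ (m + 1).centralBinom ^ 2 * (2 * (m + 1) + 1) := by gcongr; omega
        _ ≤ 16 ^ (m + 1) := centralBinom_sq_mul_le _
        _ = _ := by rw [← pow_succ', show 2 * m + 1 + 1 = 2 * (m + 1) by ring, pow_mul]; norm_num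
    omega

theorem choose_div_two_pow_le {n : ℕ} (hn : 0 < n) (i : ℕ) :
    (n.choose i : ℝ) / 2 ^ n ≤ 1 / Real.sqrt n := by
  have hn' : (0 : ℝ) < n := by exact_mod_cast hn
  rw [div_le_div_iff₀ (by positivity) (by positivity), one_mul]
  refine le_of_sq_le_sq ?_ (by positivity)
  rw [mul_pow, Real.sq_sqrt hn'.le, ← pow_mul, mul_comm n 2, pow_mul]
  norm_num
  exact_mod_cast choose_sq_mul_le n i

/-! ### Summable lattice weights. -/

/-- The sum of the weights `1 / (1 + z ^ 2)` over the integers, up to the factor lost when the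
weights are recentred at a real point. -/
noncomputable def latticeWeightBound : ℝ := 3 * ∑' z : ℤ, 1 / (1 + (z : ℝ) ^ 2)

theorem summable_one_div_one_add_int_sq : Summable fun z : ℤ => 1 / (1 + (z : ℝ) ^ 2) := by
  refine Summable.of_norm_bounded_eventually
    (Real.summable_one_div_int_pow.mpr (one_lt_two)) ?_
  have : ({0}ᶜ : Set ℤ) ∈ cofinite := (Set.finite_singleton 0).compl_mem_cofinite
  filter_upwards [this] with z hz
  have hz' : (z : ℝ) ≠ 0 := by simpa using hz
  rw [Real.norm_of_nonneg (by positivity)]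
  gcongr
  linarith

theorem latticeWeightBound_nonneg : 0 ≤ latticeWeightBound :=
  mul_nonneg (by norm_num) (tsum_nonneg fun z => by positivity)

theorem sum_one_div_one_add_sq_le (N : ℕ) (y : ℝ) :
    ∑ j ∈ Finset.range N, 1 / (1 + ((j : ℝ) - y) ^ 2) ≤ latticeWeightBound := by
  have h1 : ∀ j ∈ Finset.range N, 1 / (1 + ((j : ℝ) - y) ^ 2)
      ≤ 3 * (1 / (1 + (((j : ℤ) - ⌊y⌋ : ℤ) : ℝ) ^ 2)) := by
    intro j _
    rw [mul_one_div, div_le_div_iff₀ (by positivity) (by positivity)]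
    push_cast
    have h2 := Int.floor_le y
    have h3 := Int.lt_floor_add_one y
    -- The centre moves by `δ < 1`, and `(a + δ)² ≤ 2a² + 2δ²` yields the factor 3.
    nlinarith [sq_nonneg ((j : ℝ) - y - (y - ⌊y⌋)),
      mul_nonneg (sub_nonneg.mpr h2) (sub_nonneg.mpr h3.le)]
  refine (Finset.sum_le_sum h1).trans ?_
  rw [← Finset.mul_sum, latticeWeightBound]
  gcongr
  have hinj : Function.Injective fun j : ℕ => (j : ℤ) - ⌊y⌋ := fun a b h => by simpa using h
  have := summable_one_div_one_add_int_sq.sum_le_tsum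
    ((Finset.range N).map ⟨_, hinj⟩) (fun z _ => by positivity)
  simpa using this

/-! ### The Jackson kernel as a cosine polynomial. -/

/-- The fourth power of the modulus of the Dirichlet-type sum `∑_{r < M} exp (i r u)`. -/
noncomputable def jacksonKernel (M : ℕ) (u : ℝ) : ℝ :=
  ‖∑ r ∈ Finset.range M, Complex.exp (Complex.I * u) ^ r‖ ^ 4

theorem jacksonKernel_nonneg (M : ℕ) (u : ℝ) : 0 ≤ jacksonKernel M u := by
  unfold jacksonKernel; positivity

theorem jacksonKernel_zero (M : ℕ) : jacksonKernel M 0 = (M : ℝ) ^ 4 := by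
  simp [jacksonKernel]

/-- The quadruples indexing the frequencies of the kernel. -/
def freqIndex (M : ℕ) : Finset ((ℕ × ℕ) × (ℕ × ℕ)) :=
  (Finset.range M ×ˢ Finset.range M) ×ˢ (Finset.range M ×ˢ Finset.range M)

/-- The frequency belonging to a quadruple. -/
def freq (p : (ℕ × ℕ) × (ℕ × ℕ)) : ℤ := (p.1.1 - p.1.2) + (p.2.1 - p.2.2)

theorem abs_freq_add_two_le {M : ℕ} {p} (hp : p ∈ freqIndex M) : (freq p).natAbs + 2 ≤ 2 * M := by
  simp only [freqIndex, Finset.mem_product, Finset.mem_range] at hp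
  unfold freq
  omega

theorem jacksonKernel_eq_sum (M : ℕ) (u : ℝ) :
    jacksonKernel M u = ∑ p ∈ freqIndex M, Real.cos (freq p * u) := by
  set z := Complex.exp (Complex.I * u) with hz
  set D := ∑ r ∈ Finset.range M, z ^ r with hD
  have hsq : ((‖D‖ ^ 2 : ℝ) : ℂ) = ∑ q ∈ Finset.range M ×ˢ Finset.range M,
      Complex.exp (((q.1 : ℂ) - q.2) * u * Complex.I) := by
    push_cast
    rw [← Complex.mul_conj', hD, map_sum, Finset.sum_mul_sum, Finset.sum_product]
    refine Finset.sum_congr rfl fun a _ => Finset.sum_congr rfl fun b _ => ?_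
    rw [map_pow, hz, ← Complex.exp_conj, ← Complex.exp_nat_mul, ← Complex.exp_nat_mul,
      ← Complex.exp_add]
    congr 1
    simp
    ring
  have h4 : ((jacksonKernel M u : ℝ) : ℂ) = ∑ p ∈ freqIndex M,
      Complex.exp (((freq p : ℝ) * u : ℝ) * Complex.I) := by
    have : jacksonKernel M u = ‖D‖ ^ 2 * ‖D‖ ^ 2 := by rw [jacksonKernel]; ring
    rw [this, Complex.ofReal_mul, hsq, Finset.sum_mul_sum, freqIndex,
      Finset.sum_product (s := Finset.range M ×ˢ Finset.range M)]
    refine Finset.sum_congr rfl fun a _ => Finset.sum_congr rfl fun b _ => ?_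
    rw [← Complex.exp_add]
    congr 1
    simp [freq]
    ring
  have := congrArg Complex.re h4
  simpa only [Complex.ofReal_re, Complex.re_sum, Complex.exp_ofReal_mul_I_re] using this

/-- The zero-frequency quadruples count the additive energy of `{0, …, M - 1}`; Cauchy–Schwarz
applies because all pair sums lie below `2M`. -/
theorem pow_four_le_mul_card_freq_eq_zero (M : ℕ) :
    M ^ 4 ≤ 2 * M * ((freqIndex M).filter fun p => freq p = 0).card := by
  have h := Finset.card_sq_le_card_mul_addEnergy (Finset.range M) (Finset.range M)
    (Finset.range (2 * M))
  rw [Finset.filter_true_of_mem, Finset.card_product, Finset.card_range, Finset.card_range] at h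
  · have e : (Finset.range M).addEnergy (Finset.range M)
        = ((freqIndex M).filter fun p => freq p = 0).card := by
      unfold Finset.addEnergy freqIndex freq
      congr 1
      refine Finset.filter_congr fun p _ => ?_
      omega
    rw [e] at h
    calc M ^ 4 = (M * M) ^ 2 := by ring
      _ ≤ _ := h
  · intro p hp
    simp only [Finset.mem_product, Finset.mem_range] at hp ⊢
    omega

/-- The kernel `J(φ - ψ) + J(φ + ψ)`, an even trigonometric polynomial in both variables. -/
noncomputable def evenKernel (M : ℕ) (φ ψ : ℝ) : ℝ :=
  jacksonKernel M (φ - ψ) + jacksonKernel M (φ + ψ)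

theorem evenKernel_nonneg (M : ℕ) (φ ψ : ℝ) : 0 ≤ evenKernel M φ ψ :=
  add_nonneg (jacksonKernel_nonneg _ _) (jacksonKernel_nonneg _ _)

theorem evenKernel_eq_sum (M : ℕ) (φ ψ : ℝ) :
    evenKernel M φ ψ
      = ∑ p ∈ freqIndex M, 2 * Real.cos (freq p * ψ) * Real.cos (freq p * φ) := by
  rw [evenKernel, jacksonKernel_eq_sum, jacksonKernel_eq_sum, ← Finset.sum_add_distrib]
  refine Finset.sum_congr rfl fun p _ => ?_
  rw [mul_sub, mul_add, Real.cos_sub, Real.cos_add]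
  ring

/-! ### Midpoint quadrature. -/

/-- The midpoints of `M` equal parts of `[0, π]`. -/
noncomputable def midNode (M j : ℕ) : ℝ := (2 * j + 1) * (Real.pi / (2 * M))

theorem midNode_mem {M j : ℕ} (hj : j ∈ Finset.range M) :
    midNode M j ∈ Set.Icc 0 Real.pi := by
  have hj : j < M := by simpa using hj
  have hM : (0 : ℝ) < M := by exact_mod_cast (by omega : 0 < M)
  have hpi := Real.pi_pos
  refine ⟨by unfold midNode; positivity, ?_⟩
  have h : (2 * (j : ℝ) + 1) ≤ 2 * M := by exact_mod_cast (by omega : 2 * j + 1 ≤ 2 * M)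
  calc midNode M j ≤ 2 * M * (Real.pi / (2 * M)) := by unfold midNode; gcongr
    _ = Real.pi := by field_simp

/-- With `α = lπ/(2M)`, multiplying by `2 sin α` makes the sum telescope to `sin (lπ) = 0`; the
bound on `l` keeps `sin α` nonzero. -/
theorem sum_cos_midNode_eq_zero {M : ℕ} {l : ℤ} (hl : l ≠ 0) (hlM : l.natAbs < 2 * M) :
    ∑ j ∈ Finset.range M, Real.cos (l * midNode M j) = 0 := by
  have hM : (0 : ℝ) < M := by exact_mod_cast (by omega : 0 < M)
  have hpi := Real.pi_pos
  set α : ℝ := l * (Real.pi / (2 * M)) with hα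
  have hsin : Real.sin α ≠ 0 := by
    intro h0
    obtain ⟨z, hz⟩ := Real.sin_eq_zero_iff.mp h0
    rw [hα] at hz
    field_simp at hz
    have hz' : z * (2 * M) = l := by
      have : (z : ℝ) * (2 * M) = l := by linarith
      exact_mod_cast this
    rcases eq_or_ne z 0 with rfl | h
    · simp at hz'; exact hl hz'.symm
    · have h1 : 1 ≤ z.natAbs := Int.natAbs_pos.mpr h
      have h2 : l.natAbs = z.natAbs * (2 * M) := by
        rw [← hz', Int.natAbs_mul]; congr 1
      nlinarith
  have htel : ∑ j ∈ Finset.range M, 2 * Real.sin α * Real.cos (l * midNode M j) = 0 := by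
    have h1 : ∀ j ∈ Finset.range M, 2 * Real.sin α * Real.cos (l * midNode M j)
        = Real.sin (2 * ((j + 1 : ℕ) : ℝ) * α) - Real.sin (2 * (j : ℝ) * α) := by
      intro j _
      have e : (l : ℝ) * midNode M j = (2 * j + 1) * α := by rw [midNode, hα]; ring
      have e1 : 2 * ((j + 1 : ℕ) : ℝ) * α = (2 * j + 1) * α + α := by push_cast; ring
      have e2 : 2 * (j : ℝ) * α = (2 * j + 1) * α - α := by ring
      rw [e, e1, e2, Real.sin_add, Real.sin_sub]
      ring
    rw [Finset.sum_congr rfl h1, Finset.sum_range_sub (fun j : ℕ => Real.sin (2 * (j : ℝ) * α))]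
    have : 2 * (M : ℝ) * α = l * Real.pi := by rw [hα]; field_simp
    rw [this, Real.sin_int_mul_pi]
    simp
  rw [← Finset.mul_sum] at htel
  exact (mul_eq_zero.mp htel).resolve_left (mul_ne_zero two_ne_zero hsin)

/-- The total mass of the even kernel over the nodes. -/
noncomputable def kernelMass (M : ℕ) : ℝ :=
  2 * M * ((freqIndex M).filter fun p => freq p = 0).card

theorem pow_four_le_kernelMass (M : ℕ) : (M : ℝ) ^ 4 ≤ kernelMass M := by
  unfold kernelMass
  exact_mod_cast pow_four_le_mul_card_freq_eq_zero M

/-- All kernel frequencies are below `2M`, so only the zero ones survive, and the total does not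
depend on `φ`. -/
theorem sum_evenKernel_midNode (M : ℕ) (φ : ℝ) :
    ∑ j ∈ Finset.range M, evenKernel M φ (midNode M j) = kernelMass M := by
  simp_rw [evenKernel_eq_sum]
  rw [Finset.sum_comm, kernelMass, Finset.card_filter]
  push_cast
  rw [Finset.mul_sum]
  refine Finset.sum_congr rfl fun p hp => ?_
  rw [← Finset.sum_mul, ← Finset.mul_sum]
  split_ifs with h
  · simp [h]
  · rw [sum_cos_midNode_eq_zero h (by have := abs_freq_add_two_le hp; omega)]
    simp

/-! ### Decay of the kernel. -/

/-- The quadratically decaying weight that bounds the kernel. -/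
noncomputable def decayWeight (M : ℕ) (d : ℝ) : ℝ := 1 / (1 + (M * d / Real.pi) ^ 2)

theorem decayWeight_nonneg (M : ℕ) (d : ℝ) : 0 ≤ decayWeight M d := by
  unfold decayWeight; positivity

theorem decayWeight_le_one (M : ℕ) (d : ℝ) : decayWeight M d ≤ 1 := by
  unfold decayWeight
  rw [div_le_one (by positivity)]
  nlinarith [sq_nonneg (M * d / Real.pi)]

theorem decayWeight_le_of_abs_le (M : ℕ) {d e : ℝ} (h : |e| ≤ |d|) :
    decayWeight M d ≤ decayWeight M e := by
  unfold decayWeight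
  have : e ^ 2 ≤ d ^ 2 := sq_le_sq.mpr h
  rw [div_pow, mul_pow, div_pow, mul_pow]
  gcongr

/-- The geometric sum is bounded both by `M` and by `1 / |sin (u/2)|`. Keeping `d` apart from `u`
lets `d = φ - ψ` serve for `u = φ - ψ` and `u = φ + ψ` alike. -/
theorem jacksonKernel_le (M : ℕ) {u d : ℝ} (h : |d| ≤ Real.pi * |Real.sin (u / 2)|) :
    jacksonKernel M u ≤ 4 * (M : ℝ) ^ 4 * decayWeight M d ^ 2 := by
  set z := Complex.exp (Complex.I * u) with hz
  have hz1 : ‖z‖ = 1 := by rw [hz, mul_comm]; exact Complex.norm_exp_ofReal_mul_I u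
  set D := ∑ r ∈ Finset.range M, z ^ r with hD
  have h1 : ‖D‖ ≤ M := by
    refine (norm_sum_le _ _).trans ?_
    simp [hz1]
  have h2 : ‖D‖ * |Real.sin (u / 2)| ≤ 1 := by
    have e : ‖D‖ * ‖z - 1‖ ≤ 2 := by
      rw [← norm_mul, hD, geom_sum_mul]
      refine (norm_sub_le _ _).trans ?_
      simp [hz1]; norm_num
    rw [hz, Complex.norm_exp_I_mul_ofReal_sub_one, Real.norm_eq_abs, abs_mul, abs_two] at e
    linarith
  have hpi := Real.pi_pos
  have h3 : ‖D‖ * |d| / Real.pi ≤ 1 := by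
    rw [div_le_one hpi]
    calc ‖D‖ * |d| ≤ ‖D‖ * (Real.pi * |Real.sin (u / 2)|) := by gcongr
      _ = Real.pi * (‖D‖ * |Real.sin (u / 2)|) := by ring
      _ ≤ Real.pi * 1 := by gcongr
      _ = _ := mul_one _
  have h4 : ‖D‖ ^ 2 ≤ 2 * (M : ℝ) ^ 2 * decayWeight M d := by
    rw [decayWeight, mul_one_div, le_div_iff₀ (by positivity)]
    have e1 : ‖D‖ ^ 2 ≤ (M : ℝ) ^ 2 := by gcongr
    have e2 : (‖D‖ * |d| / Real.pi) ^ 2 ≤ 1 := pow_le_one₀ (by positivity) h3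
    have e3 : ‖D‖ ^ 2 * (M * d / Real.pi) ^ 2 = (M : ℝ) ^ 2 * (‖D‖ * |d| / Real.pi) ^ 2 := by
      rw [div_pow, div_pow, mul_pow, mul_pow, sq_abs]; ring
    have e4 : (M : ℝ) ^ 2 * (‖D‖ * |d| / Real.pi) ^ 2 ≤ (M : ℝ) ^ 2 * 1 := by gcongr
    linarith
  calc jacksonKernel M u = (‖D‖ ^ 2) ^ 2 := by rw [jacksonKernel]; ring
    _ ≤ (2 * (M : ℝ) ^ 2 * decayWeight M d) ^ 2 := by gcongr
    _ = _ := by ring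

theorem abs_sub_le_pi_mul_abs_sin {φ ψ : ℝ} (hφ : φ ∈ Set.Icc 0 Real.pi)
    (hψ : ψ ∈ Set.Icc 0 Real.pi) :
    |φ - ψ| ≤ Real.pi * |Real.sin ((φ - ψ) / 2)| := by
  obtain ⟨a, b⟩ := hφ
  obtain ⟨c, d⟩ := hψ
  have hpi := Real.pi_pos
  have key : ∀ x : ℝ, 0 ≤ x → x ≤ Real.pi → x ≤ Real.pi * |Real.sin (x / 2)| := by
    intro x h0 h1
    have := Real.mul_le_sin (x := x / 2) (by linarith) (by linarith)
    calc x = Real.pi * (2 / Real.pi * (x / 2)) := by field_simp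
      _ ≤ Real.pi * |Real.sin (x / 2)| := by gcongr; exact this.trans (le_abs_self _)
  rcases le_total 0 (φ - ψ) with h | h
  · rw [abs_of_nonneg h]; exact key _ h (by linarith)
  · rw [abs_of_nonpos h]
    have := key (-(φ - ψ)) (by linarith) (by linarith)
    rwa [neg_div, Real.sin_neg, abs_neg] at this

theorem abs_sin_half_sub_le {φ ψ : ℝ} (hφ : φ ∈ Set.Icc 0 Real.pi)
    (hψ : ψ ∈ Set.Icc 0 Real.pi) :
    |Real.sin ((φ - ψ) / 2)| ≤ |Real.sin ((φ + ψ) / 2)| := by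
  obtain ⟨a, b⟩ := hφ
  obtain ⟨c, d⟩ := hψ
  have hpi := Real.pi_pos
  have s1 : 0 ≤ Real.sin (φ / 2) := Real.sin_nonneg_of_nonneg_of_le_pi (by linarith) (by linarith)
  have s2 : 0 ≤ Real.sin (ψ / 2) := Real.sin_nonneg_of_nonneg_of_le_pi (by linarith) (by linarith)
  have c1 : 0 ≤ Real.cos (φ / 2) := Real.cos_nonneg_of_mem_Icc ⟨by linarith, by linarith⟩
  have c2 : 0 ≤ Real.cos (ψ / 2) := Real.cos_nonneg_of_mem_Icc ⟨by linarith, by linarith⟩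
  rw [sub_div, add_div, Real.sin_sub, Real.sin_add]
  refine (abs_le.mpr ⟨?_, ?_⟩).trans (le_abs_self _)
  · nlinarith [mul_nonneg s1 c2]
  · nlinarith [mul_nonneg c1 s2]

/-- The square is what the fourth power buys: one factor makes sums over nodes converge, the other
remains as decay away from the threshold. -/
theorem evenKernel_le (M : ℕ) {φ ψ : ℝ} (hφ : φ ∈ Set.Icc 0 Real.pi)
    (hψ : ψ ∈ Set.Icc 0 Real.pi) :
    evenKernel M φ ψ ≤ 8 * (M : ℝ) ^ 4 * decayWeight M (φ - ψ) ^ 2 := by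
  have h := abs_sub_le_pi_mul_abs_sin hφ hψ
  have h1 := jacksonKernel_le M h
  have h2 := jacksonKernel_le M (u := φ + ψ) (d := φ - ψ)
    (h.trans (mul_le_mul_of_nonneg_left (abs_sin_half_sub_le hφ hψ) Real.pi_pos.le))
  unfold evenKernel
  linarith

theorem sum_decayWeight_midNode_le (M : ℕ) (φ : ℝ) :
    ∑ j ∈ Finset.range M, decayWeight M (φ - midNode M j) ≤ latticeWeightBound := by
  rcases Nat.eq_zero_or_pos M with rfl | hM
  · simpa using latticeWeightBound_nonneg
  have hM : (0 : ℝ) < M := by exact_mod_cast hM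
  have hpi := Real.pi_pos
  refine le_of_eq_of_le (Finset.sum_congr rfl fun j _ => ?_)
    (sum_one_div_one_add_sq_le M (M * φ / Real.pi - 1 / 2))
  rw [decayWeight, midNode]
  congr 2
  field_simp
  ring

/-! ### Angles of the points `0, …, n`. -/

/-- The angle of the point `i` of `{0, …, n}`, mapped affinely to `[-1, 1]`. -/
noncomputable def binAngle (n i : ℕ) : ℝ := Real.arccos (1 - 2 * i / n)

theorem binAngle_mem (n i : ℕ) : binAngle n i ∈ Set.Icc 0 Real.pi :=
  ⟨Real.arccos_nonneg _, Real.arccos_le_pi _⟩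

theorem binAngle_mono (n : ℕ) : Monotone (binAngle n) := by
  intro i j h
  refine Real.antitone_arccos ?_
  gcongr

theorem cos_binAngle {n i : ℕ} (h : i ∈ Finset.range (n + 1)) :
    Real.cos (binAngle n i) = 1 - 2 * i / n := by
  have h : i ≤ n := by simpa [Nat.lt_succ_iff] using h
  have h1 : (i : ℝ) / n ≤ 1 := div_le_one_of_le₀ (by exact_mod_cast h) (by positivity)
  have h0 : 0 ≤ (i : ℝ) / n := by positivity
  rw [binAngle, Real.cos_arccos] <;> rw [mul_div_assoc] <;> linarith

/-- Cosine is 1-Lipschitz, so the angles of `i` and `j` differ by at least `2|i - j|/n`; then `M ≥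
cn` and `π ≤ 4` leave `(c/2)|i - j|` inside the square. -/
theorem decayWeight_binAngle_le {n M : ℕ} (hn : 0 < n) {c : ℝ} (hc : 0 < c) (hc1 : c ≤ 1)
    (hM : c * n ≤ M) {i j : ℕ} (hi : i ∈ Finset.range (n + 1)) (hj : j ∈ Finset.range (n + 1)) :
    decayWeight M (binAngle n i - binAngle n j)
      ≤ 4 / c ^ 2 * (1 / (1 + ((i : ℝ) - j) ^ 2)) := by
  have hn : (0 : ℝ) < n := by exact_mod_cast hn
  have hpi := Real.pi_pos
  have hpi4 := Real.pi_le_four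
  have h := Real.abs_cos_sub_cos_le (binAngle n i) (binAngle n j)
  rw [cos_binAngle hi, cos_binAngle hj] at h
  have e : (1 - 2 * (i : ℝ) / n) - (1 - 2 * j / n) = -(2 * (i - j) / n) := by ring
  rw [e, abs_neg] at h
  refine (decayWeight_le_of_abs_le M h).trans ?_
  have h2 : (c / 2) ^ 2 * ((i : ℝ) - j) ^ 2 ≤ (M * (2 * ((i : ℝ) - j) / n) / Real.pi) ^ 2 := by
    have e1 : M * (2 * ((i : ℝ) - j) / n) / Real.pi = (2 * M / (n * Real.pi)) * (i - j) := by
      field_simp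
    rw [e1, mul_pow]
    refine mul_le_mul_of_nonneg_right (pow_le_pow_left₀ (by positivity) ?_ 2) (sq_nonneg _)
    rw [div_le_div_iff₀ (by norm_num) (by positivity)]
    calc c * (n * Real.pi) = (c * n) * Real.pi := by ring
      _ ≤ M * 4 := by gcongr
      _ = 2 * M * 2 := by ring
  rw [decayWeight, div_mul_div_comm, div_le_div_iff₀ (by positivity) (by positivity)]
  nlinarith [pow_le_one₀ hc.le hc1 (n := 2)]

/-! ### Comparison of laws with equal trigonometric moments. -/

/-- Two nonnegative weights on `{0, …, n}`, one of them bounded by `β`, whose trigonometric moments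
up to `2 M - 2` agree, have distribution functions that differ by at most a multiple of `β`. -/
theorem abs_sum_sub_sum_le {n M : ℕ} (hn : 0 < n) {c : ℝ} (hc : 0 < c) (hc1 : c ≤ 1)
    (hM : c * n ≤ M) {f b : ℕ → ℝ} (hf : ∀ i, 0 ≤ f i) (hb : ∀ i, 0 ≤ b i) {β : ℝ}
    (hbβ : ∀ i, b i ≤ β)
    (hmom : ∀ l : ℤ, l.natAbs + 2 ≤ 2 * M →
      ∑ i ∈ Finset.range (n + 1), f i * Real.cos (l * binAngle n i)
        = ∑ i ∈ Finset.range (n + 1), b i * Real.cos (l * binAngle n i))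
    {m : ℕ} (hm : m ∈ Finset.range (n + 1)) :
    |∑ i ∈ (Finset.range (n + 1)).filter (· ≤ m), f i
      - ∑ i ∈ (Finset.range (n + 1)).filter (· ≤ m), b i|
      ≤ (8 * (4 / c ^ 2) * latticeWeightBound + 1) * (8 * (4 / c ^ 2) * latticeWeightBound ^ 2)
        * β := by
  set K := 4 / c ^ 2 with hK
  set W := latticeWeightBound with hW
  have hW0 : 0 ≤ W := latticeWeightBound_nonneg
  have hK0 : 0 ≤ K := by positivity
  have hβ : 0 ≤ β := (hb 0).trans (hbβ 0)
  have hM0 : (0 : ℝ) < M := lt_of_lt_of_le (by positivity) hM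
  have hG : ∀ ψ : ℝ, ∑ i ∈ Finset.range (n + 1), f i * evenKernel M (binAngle n i) ψ
      = ∑ i ∈ Finset.range (n + 1), b i * evenKernel M (binAngle n i) ψ := by
    intro ψ
    simp_rw [evenKernel_eq_sum, Finset.mul_sum]
    rw [Finset.sum_comm, Finset.sum_comm (s := Finset.range (n + 1))]
    refine Finset.sum_congr rfl fun p hp => ?_
    have := congrArg (fun x => 2 * Real.cos (freq p * ψ) * x) (hmom (freq p) (abs_freq_add_two_le hp))
    simp only [Finset.mul_sum] at this
    convert this using 2 <;> ring
  have hlat : ∀ j : ℕ, j ∈ Finset.range (n + 1) →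
      ∑ i ∈ Finset.range (n + 1), decayWeight M (binAngle n i - binAngle n j) ≤ K * W := by
    intro j hj
    calc _ ≤ ∑ i ∈ Finset.range (n + 1), K * (1 / (1 + ((i : ℝ) - j) ^ 2)) :=
          Finset.sum_le_sum fun i hi => decayWeight_binAngle_le hn hc hc1 hM hi hj
      _ ≤ K * W := by
          rw [← Finset.mul_sum]
          exact mul_le_mul_of_nonneg_left (sum_one_div_one_add_sq_le _ _) hK0
  -- The kernel peaked at the angle of `j` is at least `M ^ 4` there, so its integral against `f`
  -- dominates `f j * M ^ 4`; the same integral against `b` is controlled by `β`.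
  have hfβ : ∀ i ∈ Finset.range (n + 1), f i ≤ 8 * K * W * β := by
    intro j hj
    have h1 : f j * (M : ℝ) ^ 4 ≤ ∑ i ∈ Finset.range (n + 1),
        f i * evenKernel M (binAngle n i) (binAngle n j) := by
      refine le_trans ?_ (Finset.single_le_sum
        (f := fun i => f i * evenKernel M (binAngle n i) (binAngle n j))
        (fun i _ => mul_nonneg (hf i) (evenKernel_nonneg _ _ _)) hj)
      refine mul_le_mul_of_nonneg_left ?_ (hf j)
      rw [evenKernel, sub_self, jacksonKernel_zero]
      linarith [jacksonKernel_nonneg M (binAngle n j + binAngle n j)]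
    have h2 : ∑ i ∈ Finset.range (n + 1), b i * evenKernel M (binAngle n i) (binAngle n j)
        ≤ (8 * K * W * β) * (M : ℝ) ^ 4 := by
      calc _ ≤ ∑ i ∈ Finset.range (n + 1), β * (8 * (M : ℝ) ^ 4 *
              decayWeight M (binAngle n i - binAngle n j)) := by
            refine Finset.sum_le_sum fun i _ => mul_le_mul (hbβ i) ?_ (evenKernel_nonneg _ _ _) hβ
            refine (evenKernel_le M (binAngle_mem n i) (binAngle_mem n j)).trans ?_
            refine mul_le_mul_of_nonneg_left ?_ (by positivity)
            exact pow_le_of_le_one (decayWeight_nonneg _ _) (decayWeight_le_one _ _) two_ne_zero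
        _ = β * (8 * (M : ℝ) ^ 4) *
              ∑ i ∈ Finset.range (n + 1), decayWeight M (binAngle n i - binAngle n j) := by
            rw [Finset.mul_sum]
            exact Finset.sum_congr rfl fun i _ => by ring
        _ ≤ β * (8 * (M : ℝ) ^ 4) * (K * W) :=
            mul_le_mul_of_nonneg_left (hlat j hj) (by positivity)
        _ = _ := by ring
    rw [hG] at h1
    exact le_of_mul_le_mul_right (h1.trans h2) (by positivity)
  set Z := kernelMass M with hZ
  have hZM : (M : ℝ) ^ 4 ≤ Z := pow_four_le_kernelMass M
  have hZ0 : 0 < Z := lt_of_lt_of_le (by positivity) hZM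
  set S := (Finset.range M).filter fun j => midNode M j ≤ binAngle n m with hS
  -- `g` is the smoothed version of `Z` times the indicator of `i ≤ m`.
  set g : ℕ → ℝ := fun i => ∑ j ∈ S, evenKernel M (binAngle n i) (midNode M j) with hg
  have hgmom : ∑ i ∈ Finset.range (n + 1), f i * g i = ∑ i ∈ Finset.range (n + 1), b i * g i := by
    simp_rw [hg, Finset.mul_sum]
    rw [Finset.sum_comm, Finset.sum_comm (s := Finset.range (n + 1))]
    exact Finset.sum_congr rfl fun j _ => hG _
  have htail : ∀ i : ℕ, ∀ T ⊆ Finset.range M,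
      (∀ j ∈ T, |binAngle n i - binAngle n m| ≤ |binAngle n i - midNode M j|) →
      ∑ j ∈ T, evenKernel M (binAngle n i) (midNode M j)
        ≤ Z * (8 * W * decayWeight M (binAngle n i - binAngle n m)) := by
    intro i T hT hd
    set w := decayWeight M (binAngle n i - binAngle n m) with hw
    have hw0 : 0 ≤ w := decayWeight_nonneg _ _
    calc _ ≤ ∑ j ∈ T, 8 * (M : ℝ) ^ 4 * w * decayWeight M (binAngle n i - midNode M j) := by
          refine Finset.sum_le_sum fun j hj =>
            (evenKernel_le M (binAngle_mem n i) (midNode_mem (hT hj))).trans ?_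
          rw [sq, ← mul_assoc]
          refine mul_le_mul_of_nonneg_right ?_ (decayWeight_nonneg _ _)
          exact mul_le_mul_of_nonneg_left (decayWeight_le_of_abs_le M (hd j hj)) (by positivity)
      _ ≤ ∑ j ∈ Finset.range M, 8 * (M : ℝ) ^ 4 * w * decayWeight M (binAngle n i - midNode M j) :=
          Finset.sum_le_sum_of_subset_of_nonneg hT fun j _ _ =>
            mul_nonneg (by positivity) (decayWeight_nonneg _ _)
      _ ≤ 8 * (M : ℝ) ^ 4 * w * W := by
          rw [← Finset.mul_sum]
          exact mul_le_mul_of_nonneg_left (sum_decayWeight_midNode_le M _) (by positivity)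
      _ = (M : ℝ) ^ 4 * (8 * W * w) := by ring
      _ ≤ Z * (8 * W * w) := by gcongr
  -- The error at `i` comes only from nodes on the other side of the threshold angle, which are at
  -- least as far from `binAngle n i` as the threshold is.
  have herr : ∀ i ∈ Finset.range (n + 1), |(if i ≤ m then Z else 0) - g i|
      ≤ Z * (8 * W * decayWeight M (binAngle n i - binAngle n m)) := by
    intro i _
    split_ifs with h
    · have hsplit := Finset.sum_filter_add_sum_filter_not (Finset.range M)
        (fun j => midNode M j ≤ binAngle n m) (fun j => evenKernel M (binAngle n i) (midNode M j))
      rw [sum_evenKernel_midNode] at hsplit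
      rw [show Z - g i = ∑ j ∈ (Finset.range M).filter (fun j => ¬ midNode M j ≤ binAngle n m),
        evenKernel M (binAngle n i) (midNode M j) by rw [hZ, ← hsplit, hg]; ring,
        abs_of_nonneg (Finset.sum_nonneg fun j _ => evenKernel_nonneg _ _ _)]
      refine htail i _ (Finset.filter_subset _ _) fun j hj => ?_
      have hj := (Finset.mem_filter.mp hj).2
      have hi := binAngle_mono n h
      rw [abs_of_nonpos (by linarith), abs_of_nonpos (by linarith)]
      linarith
    · rw [zero_sub, abs_neg,
        abs_of_nonneg (Finset.sum_nonneg fun j _ => evenKernel_nonneg _ _ _)]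
      refine htail i _ (Finset.filter_subset _ _) fun j hj => ?_
      have hj := (Finset.mem_filter.mp hj).2
      have hi := binAngle_mono n (not_le.mp h).le
      rw [abs_of_nonneg (by linarith), abs_of_nonneg (by linarith)]
      linarith
  have hmain : Z * (∑ i ∈ (Finset.range (n + 1)).filter (· ≤ m), f i
      - ∑ i ∈ (Finset.range (n + 1)).filter (· ≤ m), b i)
      = ∑ i ∈ Finset.range (n + 1), (f i - b i) * ((if i ≤ m then Z else 0) - g i) := by
    have e : ∑ i ∈ Finset.range (n + 1), (f i - b i) * ((if i ≤ m then Z else 0) - g i)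
        = ∑ i ∈ Finset.range (n + 1), (f i - b i) * (if i ≤ m then Z else 0)
          - (∑ i ∈ Finset.range (n + 1), f i * g i - ∑ i ∈ Finset.range (n + 1), b i * g i) := by
      rw [← Finset.sum_sub_distrib, ← Finset.sum_sub_distrib]
      exact Finset.sum_congr rfl fun i _ => by ring
    rw [e, hgmom, sub_self, sub_zero, ← Finset.sum_sub_distrib, Finset.sum_filter, Finset.mul_sum]
    refine Finset.sum_congr rfl fun i _ => ?_
    split_ifs <;> ring
  have hB : |∑ i ∈ Finset.range (n + 1), (f i - b i) * ((if i ≤ m then Z else 0) - g i)|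
      ≤ Z * ((8 * K * W + 1) * (8 * K * W ^ 2) * β) := by
    calc _ ≤ ∑ i ∈ Finset.range (n + 1), (8 * K * W * β + β) *
          (Z * (8 * W * decayWeight M (binAngle n i - binAngle n m))) := by
          refine (Finset.abs_sum_le_sum_abs _ _).trans (Finset.sum_le_sum fun i hi => ?_)
          rw [abs_mul]
          refine mul_le_mul ?_ (herr i hi) (abs_nonneg _) (by positivity)
          refine (abs_sub _ _).trans ?_
          rw [abs_of_nonneg (hf i), abs_of_nonneg (hb i)]
          exact add_le_add (hfβ i hi) (hbβ i)
      _ = (8 * K * W * β + β) * (Z * (8 * W)) *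
          ∑ i ∈ Finset.range (n + 1), decayWeight M (binAngle n i - binAngle n m) := by
          rw [Finset.mul_sum]
          exact Finset.sum_congr rfl fun i _ => by ring
      _ ≤ (8 * K * W * β + β) * (Z * (8 * W)) * (K * W) :=
          mul_le_mul_of_nonneg_left (hlat m hm) (by positivity)
      _ = _ := by ring
  rw [← hmain, abs_mul, abs_of_pos hZ0] at hB
  exact le_of_mul_le_mul_left hB hZ0

/-! ### Moments of the distance distribution of an orthogonal array. -/

variable {n : ℕ}

/-- For an orthogonal array of strength at least `S.card`, the fraction of rows that differ from
`u` in all columns of `S`. -/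
theorem IsBinaryOrthogonalArray.two_pow_mul_card_filter {t : ℕ} {D : Finset (Fin n → ZMod 2)}
    (hD : IsBinaryOrthogonalArray t D) (S : Finset (Fin n)) (hS : S.card ≤ t)
    (u : Fin n → ZMod 2) :
    2 ^ S.card * (D.filter fun v => ∀ i ∈ S, u i ≠ v i).card = D.card := by
  obtain ⟨N, hN⟩ := hD S hS
  have h1 : (D.filter fun v => ∀ i ∈ S, u i ≠ v i).card = N := by
    rw [← hN fun i => u i + 1]
    congr 1
    refine Finset.filter_congr fun v _ => ?_
    have key : ∀ a b : ZMod 2, a ≠ b ↔ b = a + 1 := by decide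
    simp [key]
  have h2 : D.card = ∑ p : S → ZMod 2, (D.filter fun r => ∀ i : S, r i = p i).card := by
    rw [Finset.card_eq_sum_card_fiberwise (f := fun r (i : S) => r i) (t := Finset.univ)
      (by simp)]
    simp [funext_iff]
  rw [h1, h2, Finset.sum_congr rfl fun p _ => hN p]
  simp

/-- Translations permute the cube. It is the reference array whose distance distribution is
binomial. -/
theorem isBinaryOrthogonalArray_univ (t : ℕ) :
    IsBinaryOrthogonalArray t (Finset.univ : Finset (Fin n → ZMod 2)) := by
  intro S _
  refine ⟨(Finset.univ.filter fun r : Fin n → ZMod 2 => ∀ i : S, r i = 0).card, fun p => ?_⟩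
  let q : Fin n → ZMod 2 := fun i => if h : i ∈ S then p ⟨i, h⟩ else 0
  refine Finset.card_equiv (Equiv.subRight q) fun r => ?_
  simp only [Finset.mem_filter, Finset.mem_univ, true_and, Equiv.subRight_apply, Pi.sub_apply,
    sub_eq_zero]
  refine forall_congr' fun i => ?_
  simp [q]

/-- The distance is a sum of column indicators; its power expands over tuples of columns, and
repeated columns collapse in the image. -/
theorem hammingDist_pow_eq_sum (u v : Fin n → ZMod 2) (m : ℕ) :
    (hammingDist u v : ℝ) ^ m
      = ∑ s : Fin m → Fin n, if ∀ i ∈ Finset.univ.image s, u i ≠ v i then 1 else 0 := by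
  have h : (hammingDist u v : ℝ) = ∑ i : Fin n, if u i ≠ v i then 1 else 0 := by
    rw [Finset.sum_boole, hammingDist]
  rw [h, Finset.sum_pow', Fintype.piFinset_univ]
  refine Finset.sum_congr rfl fun s _ => ?_
  rw [Finset.prod_ite_zero]
  simp

/-- The moments of the Hamming distance to a fixed word, up to the strength of the array. -/
theorem IsBinaryOrthogonalArray.sum_hammingDist_pow {t : ℕ} {D : Finset (Fin n → ZMod 2)}
    (hD : IsBinaryOrthogonalArray t D) {m : ℕ} (hm : m ≤ t) (u : Fin n → ZMod 2) :
    ∑ v ∈ D, (hammingDist u v : ℝ) ^ m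
      = D.card * ∑ s : Fin m → Fin n, (1 / 2 : ℝ) ^ (Finset.univ.image s).card := by
  simp_rw [hammingDist_pow_eq_sum]
  rw [Finset.sum_comm, Finset.mul_sum]
  refine Finset.sum_congr rfl fun s _ => ?_
  have hc : (Finset.univ.image s).card ≤ t :=
    (Finset.card_image_le.trans (by simp)).trans hm
  have h := hD.two_pow_mul_card_filter _ hc u
  rw [Finset.sum_boole, ← h]
  push_cast
  rw [mul_comm, ← mul_assoc, ← mul_pow]
  norm_num

/-- The moment formula depends on the array only through its size, so `D` can be compared with the
full cube without evaluating any moment. -/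
theorem IsBinaryOrthogonalArray.sum_eval_hammingDist {t : ℕ} {D : Finset (Fin n → ZMod 2)}
    (hD : IsBinaryOrthogonalArray t D) {p : Polynomial ℝ} (hp : p.natDegree ≤ t)
    (u : Fin n → ZMod 2) :
    2 ^ n * ∑ v ∈ D, p.eval (hammingDist u v : ℝ)
      = D.card * ∑ v : Fin n → ZMod 2, p.eval (hammingDist u v : ℝ) := by
  simp_rw [Polynomial.eval_eq_sum_range' (Nat.lt_succ_of_le hp)]
  rw [Finset.sum_comm, Finset.sum_comm (s := Finset.univ), Finset.mul_sum, Finset.mul_sum]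
  refine Finset.sum_congr rfl fun m hm => ?_
  have hm : m ≤ t := by simpa [Nat.lt_succ_iff] using hm
  rw [← Finset.mul_sum, ← Finset.mul_sum, hD.sum_hammingDist_pow hm,
    (isBinaryOrthogonalArray_univ t).sum_hammingDist_pow hm]
  simp
  ring

theorem sum_univ_hammingDist (g : ℕ → ℝ) (u : Fin n → ZMod 2) :
    ∑ v : Fin n → ZMod 2, g (hammingDist u v)
      = ∑ i ∈ Finset.range (n + 1), (n.choose i : ℝ) * g i := by
  have h := Finset.sum_powerset_apply_card g (x := (Finset.univ : Finset (Fin n)))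
  simp only [Finset.card_univ, Fintype.card_fin, nsmul_eq_mul] at h
  rw [← h]
  refine Finset.sum_bij' (fun v _ => Finset.univ.filter fun i => u i ≠ v i)
    (fun S _ i => if i ∈ S then u i + 1 else u i) ?_ ?_ ?_ ?_ ?_
  · simp
  · simp
  · intro v _
    have key : ∀ a b : ZMod 2, a ≠ b → a + 1 = b := by decide
    ext i
    by_cases hi : u i = v i
    · simp [hi]
    · simp [hi, key _ _ hi]
  · intro S _
    ext i
    by_cases hi : i ∈ S <;> simp [hi]
  · intro v _
    simp [hammingDist]

theorem sum_distFrequency_mul (D : Finset (Fin n → ZMod 2)) (g : ℕ → ℝ) :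
    ∑ i ∈ Finset.range (n + 1), distFrequency D i * g i
      = (∑ u ∈ D, ∑ v ∈ D, g (hammingDist u v)) / (D.card : ℝ) ^ 2 := by
  rw [← Finset.sum_product', ← Finset.sum_fiberwise_of_maps_to (s := D ×ˢ D)
    (t := Finset.range (n + 1)) (g := fun r => hammingDist r.1 r.2), Finset.sum_div]
  · refine Finset.sum_congr rfl fun i _ => ?_
    rw [Finset.sum_congr rfl (g := fun _ => g i)
      (fun r hr => by rw [(Finset.mem_filter.mp hr).2])]
    rw [Finset.sum_const, nsmul_eq_mul, distFrequency]
    ring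
  · intro r _
    have : hammingDist r.1 r.2 ≤ n := by simpa using hammingDist_le_card_fintype (x := r.1) (y := r.2)
    simpa [Nat.lt_succ_iff] using this

/-- The distance distribution of an orthogonal array has the binomial moments up to its
strength. -/
theorem IsBinaryOrthogonalArray.sum_distFrequency_mul_eval {t : ℕ}
    {D : Finset (Fin n → ZMod 2)} (hD : IsBinaryOrthogonalArray t D) (hne : D.Nonempty)
    {p : Polynomial ℝ} (hp : p.natDegree ≤ t) :
    ∑ i ∈ Finset.range (n + 1), distFrequency D i * p.eval (i : ℝ)
      = ∑ i ∈ Finset.range (n + 1), (n.choose i : ℝ) / 2 ^ n * p.eval (i : ℝ) := by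
  have hc : (D.card : ℝ) ≠ 0 := by simpa using hne.ne_empty
  rw [sum_distFrequency_mul D fun i => p.eval (i : ℝ)]
  have h : ∀ u ∈ D, ∑ v ∈ D, p.eval (hammingDist u v : ℝ)
      = D.card * ∑ i ∈ Finset.range (n + 1), (n.choose i : ℝ) / 2 ^ n * p.eval (i : ℝ) := by
    intro u _
    have h1 := hD.sum_eval_hammingDist hp u
    rw [sum_univ_hammingDist (fun i => p.eval (i : ℝ))] at h1
    have h2 : ∑ i ∈ Finset.range (n + 1), (n.choose i : ℝ) / 2 ^ n * p.eval (i : ℝ)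
        = (∑ i ∈ Finset.range (n + 1), (n.choose i : ℝ) * p.eval (i : ℝ)) / 2 ^ n := by
      rw [Finset.sum_div]
      exact Finset.sum_congr rfl fun i _ => by ring
    rw [h2, ← mul_div_assoc, eq_div_iff (by positivity), ← h1]
    ring
  rw [Finset.sum_congr rfl h, Finset.sum_const, nsmul_eq_mul]
  field_simp

theorem IsBinaryOrthogonalArray.sum_distFrequency_mul_cos {t : ℕ}
    {D : Finset (Fin n → ZMod 2)} (hD : IsBinaryOrthogonalArray t D) (hne : D.Nonempty)
    {l : ℤ} (hl : l.natAbs ≤ t) :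
    ∑ i ∈ Finset.range (n + 1), distFrequency D i * Real.cos (l * binAngle n i)
      = ∑ i ∈ Finset.range (n + 1), (n.choose i : ℝ) / 2 ^ n * Real.cos (l * binAngle n i) := by
  -- `cos (l φ) = T_l (cos φ)`, and `cos φ` is affine in `i`.
  set p : Polynomial ℝ := (Polynomial.Chebyshev.T ℝ l).comp
    (Polynomial.C 1 - Polynomial.C (2 / (n : ℝ)) * Polynomial.X) with hp
  have hdeg : p.natDegree ≤ t := by
    refine (Polynomial.natDegree_comp_le).trans ?_
    rw [Polynomial.Chebyshev.natDegree_T]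
    refine (mul_le_of_le_one_right (Nat.zero_le _) ?_).trans hl
    compute_degree
  have heval : ∀ i ∈ Finset.range (n + 1), Real.cos (l * binAngle n i) = p.eval (i : ℝ) := by
    intro i hi
    rw [← Polynomial.Chebyshev.T_real_cos, cos_binAngle hi, hp, Polynomial.eval_comp]
    congr 1
    simp
    ring
  rw [Finset.sum_congr rfl fun i hi => by rw [heval i hi],
    hD.sum_distFrequency_mul_eval hne hdeg]
  exact Finset.sum_congr rfl fun i hi => by rw [heval i hi]

theorem distFrequency_nonneg (D : Finset (Fin n → ZMod 2)) (i : ℕ) : 0 ≤ distFrequency D i := by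
  unfold distFrequency; positivity

/-! ### Conclusion for orthogonal arrays. -/

theorem IsBinaryOrthogonalArray.abs_distCDF_sub_binomialCDF_le {M t : ℕ} (hn : 0 < n) {c : ℝ}
    (hc : 0 < c) (hc1 : c ≤ 1) (hM : c * n ≤ M) (hMt : 2 * M ≤ t + 2)
    {D : Finset (Fin n → ZMod 2)} (hD : IsBinaryOrthogonalArray t D) (hne : D.Nonempty) (x : ℝ) :
    |distCDF D x - binomialCDF n x| ≤
      (8 * (4 / c ^ 2) * latticeWeightBound + 1) * (8 * (4 / c ^ 2) * latticeWeightBound ^ 2)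
        / Real.sqrt n := by
  have hW := latticeWeightBound_nonneg
  unfold distCDF binomialCDF
  rcases lt_or_ge x 0 with hx | hx
  · have hempty : (Finset.range (n + 1)).filter (fun i : ℕ => (i : ℝ) ≤ x) = ∅ :=
      Finset.filter_false_of_mem fun i _ h => by
        have : (0 : ℝ) ≤ i := by positivity
        linarith
    rw [hempty, Finset.sum_empty, Finset.sum_empty, sub_self, abs_zero]
    positivity
  · have hfilter : (Finset.range (n + 1)).filter (fun i : ℕ => (i : ℝ) ≤ x)
        = (Finset.range (n + 1)).filter (· ≤ min ⌊x⌋₊ n) := by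
      refine Finset.filter_congr fun i hi => ?_
      have hi : i ≤ n := by simpa [Nat.lt_succ_iff] using hi
      rw [le_min_iff, Nat.le_floor_iff hx]
      simp [hi]
    rw [hfilter]
    have := abs_sum_sub_sum_le hn hc hc1 hM (distFrequency_nonneg D)
      (b := fun i => (n.choose i : ℝ) / 2 ^ n) (fun i => by positivity)
      (choose_div_two_pow_le hn)
      (fun l hl => hD.sum_distFrequency_mul_cos hne (by omega))
      (m := min ⌊x⌋₊ n) (by simp)
    rwa [mul_one_div] at this

theorem theorem15 (θ : ℝ) (hθ0 : 0 < θ) (hθ1 : θ < 1) (A : ℝ) :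
    ∃ C : ℝ, ∀ k : ℕ → ℕ, (fun n : ℕ => (k n : ℝ)) ~[atTop] (fun n : ℕ => θ * (n : ℝ)) →
      ∀ᶠ n : ℕ in atTop, ∀ x : ℝ, |x - (n : ℝ) / 2| ≤ A * Real.sqrt n →
        ∀ D : Finset (Fin n → ZMod 2), D.Nonempty →
          ∀ t : ℕ, 2 * k n + 1 ≤ t → IsBinaryOrthogonalArray t D →
            |distCDF D x - binomialCDF n x| ≤ C / Real.sqrt n := by
  refine ⟨(8 * (4 / (θ / 2) ^ 2) * latticeWeightBound + 1) *
    (8 * (4 / (θ / 2) ^ 2) * latticeWeightBound ^ 2), fun k hk => ?_⟩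
  -- A relative error of at most one half gives `k n ≥ (θ/2) n`. With `M = k n + 1` the kernel
  -- degree `2M - 2 = 2 * k n` stays within the strength.
  have hlo := hk.isLittleO.def (c := 1 / 2) (by norm_num)
  filter_upwards [hlo, eventually_gt_atTop 0] with n h hn x _ D hne t ht hD
  refine hD.abs_distCDF_sub_binomialCDF_le (c := θ / 2) (M := k n + 1) hn (by linarith)
    (by linarith) ?_ (by omega) hne x
  have h0 : 0 ≤ θ * (n : ℝ) := by positivity
  simp only [Pi.sub_apply, Real.norm_eq_abs, abs_of_nonneg h0] at h
  have := (abs_le.mp h).1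
  push_cast
  linarith
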